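/- Let $\mathcal C$ be an exact Goursat category: $\mathcal C$ is regular (it has finite limits, every kernel pair has a coequaliser, and regular epimorphisms are stable under pullback), every internal equivalence relation in $\mathcal C$ is effective (a kernel pair), and $RSR=SRS$ for any two equivalence relations $R,S$ on the same object of $\mathcal C$. Let $\mathcal X$ be a Birkhoff subcategory of $\mathcal C$, i.e. a full reflective subcategory with inclusion $U\colon\mathcal X\to\mathcal C$ and reflector $I\dashv U$, such that every component $\eta_A\colon A\to UI(A)$ of the unit is a regular epimorphism and $\mathcal X$ is closed in $\mathcal C$ under regular quotients (if $A\to B$ is a regular epimorphism in $\mathcal C$ and $A$ lies in $\mathcal X$, then so does $B$). Then $I\colon\mathcal C\to\mathcal X$ preserves pullbacks of split epimorphisms along regular epimorphisms: if $$\begin{array}{ccc} P & \xrightarrow{\;p_2\;} & D\\ {\scriptstyle p_1}\downarrow & & \downarrow{\scriptstyle g}\\ A & \xrightarrow{\;p\;} & B\end{array}$$ is a pullback in $\mathcal C$ with $g$ a split epimorphism and $p$ a regular epimorphism, then its image under $I$ is a pullback in $\mathcal X$. -/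

import Mathlib

open CategoryTheory CategoryTheory.Limits

universe v v' u u'

namespace GoursatReflection

section Relations

variable {C : Type u} [Category.{v} C] [Regular C]

/-- An internal relation from `X` to `Y`: a subobject of the product of `X` and `Y`. -/
abbrev InternalRel (X Y : C) := Subobject (X ⨯ Y)

/-- The first leg of an internal relation. -/
noncomputable def InternalRel.leg₁ {X Y : C} (R : InternalRel X Y) : (R : C) ⟶ X :=
  R.arrow ≫ prod.fst

/-- The second leg of an internal relation. -/
noncomputable def InternalRel.leg₂ {X Y : C} (R : InternalRel X Y) : (R : C) ⟶ Y :=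
  R.arrow ≫ prod.snd

/-- The composite relation, containing `(x, z)` when `(x, y)` lies in `R` and `(y, z)` lies in `S`
for some `y`: the image in the product of `X` and `Z` of the pullback of `R` and `S` over `Y`. -/
noncomputable def InternalRel.comp {X Y Z : C} (R : InternalRel X Y) (S : InternalRel Y Z) :
    InternalRel X Z :=
  imageSubobject
    (prod.lift (pullback.fst R.leg₂ S.leg₁ ≫ R.leg₁) (pullback.snd R.leg₂ S.leg₁ ≫ S.leg₂))

end Relations

/-- A (Barr-)exact category: a regular category in which every internal equivalence relation is
effective, that is, the kernel pair of its coequaliser. -/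
class BarrExact (C : Type u) [Category.{v} C] : Prop extends Regular C where
  isEffective {R X : C} (p₁ p₂ : R ⟶ X) :
    IsEquivalenceRelation p₁ p₂ → IsEffectiveEquivalenceRelation p₁ p₂

/-- A regular category is a Goursat category when the composition of effective equivalence
relations on the same object is 3-permutable. -/
class Goursat (C : Type u) [Category.{v} C] [Regular C] : Prop where
  three_permutable {X : C} (R S : InternalRel X X) :
    IsEffectiveEquivalenceRelation R.leg₁ R.leg₂ →
    IsEffectiveEquivalenceRelation S.leg₁ S.leg₂ →
    (R.comp S).comp R = (S.comp R).comp S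

/-- `U : X ⥤ C`, with left adjoint `I`, is the inclusion of a Birkhoff subcategory: `U` is fully
faithful, the components of the unit of the adjunction are regular epimorphisms, and the objects
(isomorphic to one) in the image of `U` are closed under regular quotients in `C`. -/
structure IsBirkhoff {C : Type u} [Category.{v} C] {X : Type u'} [Category.{v'} X]
    {I : C ⥤ X} {U : X ⥤ C} (adj : I ⊣ U) : Prop where
  full : U.Full
  faithful : U.Faithful
  isRegularEpi_unit (A : C) : IsRegularEpi (adj.unit.app A)
  closed_quotients {A B : C} (q : A ⟶ B) : IsRegularEpi q → U.essImage A → U.essImage B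

end GoursatReflection

namespace GoursatReflection

attribute [local simp] prod.lift_fst prod.lift_snd prod.lift_fst_assoc prod.lift_snd_assoc
  pullback.lift_fst pullback.lift_snd pullback.lift_fst_assoc pullback.lift_snd_assoc

/-! ### Generalized elements, covers and relations in a regular category -/

section Covers

variable {C : Type u} [Category.{v} C] [Regular C]

/-! The comparison `φ` from `UI(P)` to the pullback of `UI(A)` and `UI(D)` over `UI(B)` is an
isomorphism because it is a regular epi and mono; `U`, being fully faithful, reflects the resulting
pullback. Write `η` for the unit. Closure under quotients makes the kernel pair of `η_P` cover that
of `η_B` for every regular epi `P ⟶ B` (`exists_lift_kernel`). Given this, 3-permutability makes `φ`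
a regular epi, and the shifting lemma, used twice, makes it mono; only the latter needs the section
of `g`. -/

theorem isRegularEpi_of_strongEpi {X Y : C} (f : X ⟶ Y) [StrongEpi f] : IsRegularEpi f :=
  inferInstance

theorem isRegularEpi_comp {X Y Z : C} (f : X ⟶ Y) (g : Y ⟶ Z) [IsRegularEpi f] [IsRegularEpi g] :
    IsRegularEpi (f ≫ g) :=
  have := strongEpi_comp f g
  isRegularEpi_of_strongEpi _

/-- The right factor of a regular epimorphism in a regular category is a regular epimorphism. -/
theorem isRegularEpi_of_fac {X Y Z : C} {f : X ⟶ Y} {g : Y ⟶ Z} {h : X ⟶ Z} (w : f ≫ g = h)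
    [IsRegularEpi h] : IsRegularEpi g := by
  subst w
  have := strongEpi_of_strongEpi f g
  exact isRegularEpi_of_strongEpi _

/-- Generalized elements lift along regular epimorphisms after passing to a cover. -/
theorem exists_lift {X Y T : C} (f : X ⟶ Y) [IsRegularEpi f] (y : T ⟶ Y) :
    ∃ (T' : C) (c : T' ⟶ T) (x : T' ⟶ X), IsRegularEpi c ∧ x ≫ f = c ≫ y :=
  ⟨_, pullback.snd f y, pullback.fst f y, inferInstance, pullback.condition⟩

/-- Factorization through a monomorphism may be checked on a cover. -/
theorem exists_fac_of_cover {C : Type u} [Category.{v} C] {J Y T T' : C} (m : J ⟶ Y)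
    [Mono m] (c : T' ⟶ T) [IsRegularEpi c]
    (k : T ⟶ Y) (l : T' ⟶ J) (w : l ≫ m = c ≫ k) : ∃ d : T ⟶ J, d ≫ m = k :=
  have sq : CommSq l c m k := ⟨w⟩
  ⟨sq.lift, sq.fac_right⟩

instance isRegularEpi_factorThruImageSubobject {X Y : C} (f : X ⟶ Y) :
    IsRegularEpi (factorThruImageSubobject f) := by
  have : StrongEpi (factorThruImageSubobject f) := by
    unfold factorThruImageSubobject
    exact strongEpi_comp _ _
  exact isRegularEpi_of_strongEpi _

namespace InternalRel

variable {X Y Z T : C}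

/-- The generalized elements `x` and `y` are related by `R`. -/
def Holds (R : InternalRel X Y) (x : T ⟶ X) (y : T ⟶ Y) : Prop :=
  ∃ r : T ⟶ (R : C), r ≫ R.leg₁ = x ∧ r ≫ R.leg₂ = y

theorem exists_cover_comp (R : InternalRel X Y) (S : InternalRel Y Z) :
    ∃ e : pullback R.leg₂ S.leg₁ ⟶ (R.comp S : C), IsRegularEpi e ∧
      e ≫ (R.comp S).leg₁ = pullback.fst R.leg₂ S.leg₁ ≫ R.leg₁ ∧
      e ≫ (R.comp S).leg₂ = pullback.snd R.leg₂ S.leg₁ ≫ S.leg₂ := by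
  let k := prod.lift (pullback.fst R.leg₂ S.leg₁ ≫ R.leg₁) (pullback.snd R.leg₂ S.leg₁ ≫ S.leg₂)
  have hk : factorThruImageSubobject k ≫ (imageSubobject k).arrow = k :=
    imageSubobject_arrow_comp k
  exact ⟨factorThruImageSubobject k, isRegularEpi_factorThruImageSubobject k,
    ((reassoc_of% hk) _).trans (prod.lift_fst _ _), ((reassoc_of% hk) _).trans (prod.lift_snd _ _)⟩

theorem Holds.comp {R : InternalRel X Y} {S : InternalRel Y Z} {x : T ⟶ X} {y : T ⟶ Y}
    {z : T ⟶ Z} (hR : R.Holds x y) (hS : S.Holds y z) : (R.comp S).Holds x z := by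
  obtain ⟨r, hr₁, hr₂⟩ := hR
  obtain ⟨s, hs₁, hs₂⟩ := hS
  obtain ⟨e, -, he₁, he₂⟩ := exists_cover_comp R S
  refine ⟨pullback.lift r s (hr₂.trans hs₁.symm) ≫ e, ?_, ?_⟩
  · rw [Category.assoc, he₁, pullback.lift_fst_assoc, hr₁]
  · rw [Category.assoc, he₂, pullback.lift_snd_assoc, hs₂]

/-- The composite is an image, so the middle element exists only on a cover. -/
theorem Holds.exists_of_comp {R : InternalRel X Y} {S : InternalRel Y Z} {x : T ⟶ X}
    {z : T ⟶ Z} (h : (R.comp S).Holds x z) :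
    ∃ (T' : C) (c : T' ⟶ T) (y : T' ⟶ Y), IsRegularEpi c ∧
      R.Holds (c ≫ x) y ∧ S.Holds y (c ≫ z) := by
  obtain ⟨r, rfl, rfl⟩ := h
  obtain ⟨e, he, he₁, he₂⟩ := exists_cover_comp R S
  obtain ⟨T', c, t, hc, ht⟩ := exists_lift e r
  refine ⟨T', c, t ≫ pullback.fst R.leg₂ S.leg₁ ≫ R.leg₂, hc,
    ⟨t ≫ pullback.fst R.leg₂ S.leg₁, ?_, by simp⟩,
    ⟨t ≫ pullback.snd R.leg₂ S.leg₁, by simp [pullback.condition], ?_⟩⟩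
  · rw [← reassoc_of% ht, he₁, Category.assoc]
  · rw [← reassoc_of% ht, he₂, Category.assoc]

end InternalRel

instance mono_lift_kernelPair {X Y : C} (f : X ⟶ Y) :
    Mono (prod.lift (pullback.fst f f) (pullback.snd f f)) :=
  ⟨fun a b h => pullback.hom_ext (by simpa using h =≫ prod.fst) (by simpa using h =≫ prod.snd)⟩

/-- The kernel pair of a morphism, as an internal relation. -/
noncomputable def kernelRel {X Y : C} (f : X ⟶ Y) : InternalRel X X :=
  Subobject.mk (prod.lift (pullback.fst f f) (pullback.snd f f))

theorem isKernelPair_kernelRel {X Y : C} (f : X ⟶ Y) :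
    IsKernelPair f (kernelRel f).leg₁ (kernelRel f).leg₂ := by
  refine IsPullback.of_iso (IsPullback.of_hasPullback f f)
    (Subobject.underlyingIso (prod.lift (pullback.fst f f) (pullback.snd f f))).symm
    (Iso.refl _) (Iso.refl _) (Iso.refl _) ?_ ?_ (by simp) (by simp) <;>
  simp [InternalRel.leg₁, InternalRel.leg₂, kernelRel]

theorem kernelRel_holds_iff {X Y T : C} (f : X ⟶ Y) (x y : T ⟶ X) :
    (kernelRel f).Holds x y ↔ x ≫ f = y ≫ f := by
  constructor
  · rintro ⟨r, rfl, rfl⟩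
    simp [(isKernelPair_kernelRel f).w]
  · intro h
    exact ⟨(isKernelPair_kernelRel f).lift x y h, by simp, by simp⟩

end Covers

/-! ### Permutability, shifting and images of kernel pairs -/

section Exact

variable {C : Type u} [Category.{v} C] [BarrExact C]

theorem isEffective_kernelRel {X Y : C} (f : X ⟶ Y) :
    IsEffectiveEquivalenceRelation (kernelRel f).leg₁ (kernelRel f).leg₂ :=
  BarrExact.isEffective _ _ (IsKernelPair.equivalenceRelation f _ _ (limit.isLimit _)
    (isKernelPair_kernelRel f)).isEquivalenceRelation

variable [Goursat C]

/-- 3-permutability of kernel pairs, in terms of generalized elements. -/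
theorem exists_permute {X Y Z T : C} (f : X ⟶ Y) (g : X ⟶ Z) {x₀ x₁ x₂ x₃ : T ⟶ X}
    (h₀ : x₀ ≫ f = x₁ ≫ f) (h₁ : x₁ ≫ g = x₂ ≫ g) (h₂ : x₂ ≫ f = x₃ ≫ f) :
    ∃ (T' : C) (c : T' ⟶ T) (y₁ y₂ : T' ⟶ X), IsRegularEpi c ∧
      c ≫ x₀ ≫ g = y₁ ≫ g ∧ y₁ ≫ f = y₂ ≫ f ∧ y₂ ≫ g = c ≫ x₃ ≫ g := by
  have h : (((kernelRel f).comp (kernelRel g)).comp (kernelRel f)).Holds x₀ x₃ :=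
    (((kernelRel_holds_iff f _ _).2 h₀).comp ((kernelRel_holds_iff g _ _).2 h₁)).comp
      ((kernelRel_holds_iff f _ _).2 h₂)
  rw [Goursat.three_permutable _ _ (isEffective_kernelRel f) (isEffective_kernelRel g)] at h
  obtain ⟨T₁, c₁, y₂, hc₁, h, h₂'⟩ := h.exists_of_comp
  obtain ⟨T₂, c₂, y₁, hc₂, h₀', h₁'⟩ := h.exists_of_comp
  rw [kernelRel_holds_iff] at h₀' h₁' h₂'
  exact ⟨T₂, c₂ ≫ c₁, y₁, c₂ ≫ y₂, isRegularEpi_comp _ _, by simpa using h₀', h₁',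
    by simpa using c₂ ≫= h₂'⟩

/-- Gumm's shifting lemma for kernel pairs. -/
theorem shifting {P X Y Z T : C} (f : P ⟶ X) (g : P ⟶ Y) (t : P ⟶ Z)
    (hfg : ∀ ⦃W : C⦄ (a b : W ⟶ P), a ≫ f = b ≫ f → a ≫ g = b ≫ g → a ≫ t = b ≫ t)
    {x y u v : T ⟶ P} (hxu : x ≫ f = u ≫ f) (hyv : y ≫ f = v ≫ f) (hxy : x ≫ g = y ≫ g)
    (huv : u ≫ g = v ≫ g) (huv' : u ≫ t = v ≫ t) : x ≫ t = y ≫ t := by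
  -- Pairing `t` with `g` keeps `y₁` and `y₂` equal under `g`, since `x` and `y` are; `hfg` then
  -- applies to them.
  obtain ⟨T', c, y₁, y₂, hc, h₀, h₁, h₂⟩ := exists_permute f (prod.lift t g) hxu
    (by simp [prod.comp_lift, huv, huv']) hyv.symm
  have h₀t : c ≫ x ≫ t = y₁ ≫ t := by simpa using h₀ =≫ prod.fst
  have h₀g : c ≫ x ≫ g = y₁ ≫ g := by simpa using h₀ =≫ prod.snd
  have h₂t : y₂ ≫ t = c ≫ y ≫ t := by simpa using h₂ =≫ prod.fst
  have h₂g : y₂ ≫ g = c ≫ y ≫ g := by simpa using h₂ =≫ prod.snd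
  rw [← cancel_epi c, h₀t, ← h₂t]
  exact hfg _ _ h₁ (by rw [← h₀g, h₂g, hxy])

/-- In an exact Goursat category, the image along a regular epimorphism of a kernel pair is again
a kernel pair. -/
theorem exists_quotient {P B Z : C} (h : P ⟶ B) [IsRegularEpi h] (t : P ⟶ Z) :
    ∃ (Q : C) (q : B ⟶ Q), IsRegularEpi q ∧
      (∀ ⦃T : C⦄ (x y : T ⟶ P), x ≫ t = y ≫ t → x ≫ h ≫ q = y ≫ h ≫ q) ∧
      ∀ ⦃T : C⦄ (b₀ b₁ : T ⟶ B), b₀ ≫ q = b₁ ≫ q →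
        ∃ (T' : C) (c : T' ⟶ T) (x₀ x₁ : T' ⟶ P), IsRegularEpi c ∧
          x₀ ≫ h = c ≫ b₀ ∧ x₁ ≫ h = c ≫ b₁ ∧ x₀ ≫ t = x₁ ≫ t := by
  let k : pullback t t ⟶ B ⨯ B := prod.lift (pullback.fst t t ≫ h) (pullback.snd t t ≫ h)
  let J : InternalRel B B := imageSubobject k
  let e : pullback t t ⟶ (J : C) := factorThruImageSubobject k
  have he : e ≫ J.arrow = k := imageSubobject_arrow_comp k
  have e₁ : e ≫ J.leg₁ = pullback.fst t t ≫ h := by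
    rw [InternalRel.leg₁, reassoc_of% he]; simp [k]
  have e₂ : e ≫ J.leg₂ = pullback.snd t t ≫ h := by
    rw [InternalRel.leg₂, reassoc_of% he]; simp [k]
  have e_epi : IsRegularEpi e := isRegularEpi_factorThruImageSubobject k
  -- membership in `J` may be established on a cover
  have mem {T : C} (b₀ b₁ : T ⟶ B) {T' : C} (c : T' ⟶ T) [IsRegularEpi c] (x₀ x₁ : T' ⟶ P)
      (h₀ : x₀ ≫ h = c ≫ b₀) (h₁ : x₁ ≫ h = c ≫ b₁) (hx : x₀ ≫ t = x₁ ≫ t) :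
      ∃ j : T ⟶ (J : C), j ≫ J.leg₁ = b₀ ∧ j ≫ J.leg₂ = b₁ := by
    obtain ⟨d, hd⟩ := exists_fac_of_cover J.arrow c (prod.lift b₀ b₁)
      (pullback.lift x₀ x₁ hx ≫ e)
      (by rw [Category.assoc, he]; ext <;> simp [k, h₀, h₁])
    exact ⟨d, by simp [InternalRel.leg₁, reassoc_of% hd],
      by simp [InternalRel.leg₂, reassoc_of% hd]⟩
  have cov {T : C} (j : T ⟶ (J : C)) : ∃ (T' : C) (c : T' ⟶ T) (x₀ x₁ : T' ⟶ P),
      IsRegularEpi c ∧ x₀ ≫ h = c ≫ j ≫ J.leg₁ ∧ x₁ ≫ h = c ≫ j ≫ J.leg₂ ∧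
        x₀ ≫ t = x₁ ≫ t := by
    obtain ⟨T', c, z, hc, hz⟩ := exists_lift e j
    exact ⟨T', c, z ≫ pullback.fst t t, z ≫ pullback.snd t t, hc,
      by rw [← reassoc_of% hz, e₁, Category.assoc], by rw [← reassoc_of% hz, e₂, Category.assoc],
      by simp [pullback.condition]⟩
  obtain ⟨r, hr₁, hr₂⟩ := mem (𝟙 B) (𝟙 B) h (𝟙 P) (𝟙 P) (by simp) (by simp) rfl
  obtain ⟨s, hs₁, hs₂⟩ : ∃ s : (J : C) ⟶ (J : C), s ≫ J.leg₁ = J.leg₂ ∧ s ≫ J.leg₂ = J.leg₁ := by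
    obtain ⟨T', c, x₀, x₁, hc, h₀, h₁, hx⟩ := cov (𝟙 (J : C))
    exact mem _ _ c x₁ x₀ (by simpa using h₁) (by simpa using h₀) hx.symm
  obtain ⟨m, hm₁, hm₂⟩ : ∃ m : pullback J.leg₂ J.leg₁ ⟶ (J : C),
      m ≫ J.leg₁ = pullback.fst _ _ ≫ J.leg₁ ∧ m ≫ J.leg₂ = pullback.snd _ _ ≫ J.leg₂ := by
    obtain ⟨T₁, c₁, x₀, x₁, hc₁, h₀, h₁, hx⟩ := cov (pullback.fst J.leg₂ J.leg₁)
    obtain ⟨T₂, c₂, y₀, y₁, hc₂, h₀', h₁', hy⟩ := cov (c₁ ≫ pullback.snd J.leg₂ J.leg₁)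
    -- Transitivity is where the Goursat law enters: the chain `t`, `h`, `t` becomes `h`, `t`, `h`,
    -- whose middle link maps under `h` to the required pair.
    obtain ⟨T₃, c₃, z₀, z₁, hc₃, w₀, w, w₁⟩ := exists_permute t h
      (x₀ := c₂ ≫ x₀) (x₁ := c₂ ≫ x₁) (x₂ := y₀) (x₃ := y₁)
      (by simp [hx]) (by simp [h₁, h₀', pullback.condition]) hy
    have := isRegularEpi_comp c₂ c₁
    have := isRegularEpi_comp c₃ (c₂ ≫ c₁)
    exact mem _ _ (c₃ ≫ c₂ ≫ c₁) z₀ z₁ (by simp [← w₀, h₀]) (by simp [w₁, h₁']) w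
  have hJ : IsEquivalenceRelation J.leg₁ J.leg₂ := by
    refine EquivalenceRelation.isEquivalenceRelation
      { right_cancellation := fun Y a b ha hb => ?_
        r := r
        reflexivity₁ := hr₁
        reflexivity₂ := hr₂
        s := s
        symmetry₁ := hs₁
        symmetry₂ := hs₂
        c := _
        isLimit := limit.isLimit _
        t := m
        transitivity₁ := hm₁
        transitivity₂ := hm₂ }
    rw [← cancel_mono J.arrow]
    ext
    · simpa [InternalRel.leg₁] using ha
    · simpa [InternalRel.leg₂] using hb
  obtain ⟨⟨E⟩⟩ := BarrExact.isEffective _ _ hJ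
  refine ⟨E.B, E.π, inferInstance, fun T x y hxy => ?_, fun T b₀ b₁ hb => ?_⟩
  · obtain ⟨j, hj₁, hj₂⟩ := mem (x ≫ h) (y ≫ h) (𝟙 T) x y (by simp) (by simp) hxy
    have := j ≫= E.isKernelPair.w
    rwa [reassoc_of% hj₁, reassoc_of% hj₂] at this
  · obtain ⟨T', c, x₀, x₁, hc, h₀, h₁, hx⟩ := cov (E.isKernelPair.lift b₀ b₁ hb)
    exact ⟨T', c, x₀, x₁, hc, by simpa using h₀, by simpa using h₁, hx⟩

variable {X : Type u'} [Category.{v'} X] {I : C ⥤ X} {U : X ⥤ C} {adj : I ⊣ U}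

/-- For a Birkhoff subcategory, the kernel pair of the unit at `P` covers the kernel pair of the
unit at any regular quotient of `P`. -/
theorem IsBirkhoff.exists_lift_kernel (hX : IsBirkhoff adj) {P B T : C} (h : P ⟶ B)
    [IsRegularEpi h] (b₀ b₁ : T ⟶ B) (hb : b₀ ≫ adj.unit.app B = b₁ ≫ adj.unit.app B) :
    ∃ (T' : C) (c : T' ⟶ T) (x₀ x₁ : T' ⟶ P), IsRegularEpi c ∧
      x₀ ≫ h = c ≫ b₀ ∧ x₁ ≫ h = c ≫ b₁ ∧ x₀ ≫ adj.unit.app P = x₁ ≫ adj.unit.app P := by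
  obtain ⟨Q, q, hq, hPQ, hcov⟩ := exists_quotient h (adj.unit.app P)
  have := hX.isRegularEpi_unit P
  have hhq := isRegularEpi_comp h q
  -- `Q` is a regular quotient of `UI(P)`, so it lies in the subcategory and `q` factors through
  -- `η_B`; hence `η_B` identifies no more than `q` does.
  let w : U.obj (I.obj P) ⟶ Q := IsRegularEpi.desc (adj.unit.app P) (h ≫ q)
    (hPQ _ _ (IsRegularEpi.w _))
  have hw : adj.unit.app P ≫ w = h ≫ q := IsRegularEpi.fac _ _ _
  obtain ⟨Q', ⟨i⟩⟩ := hX.closed_quotients w (isRegularEpi_of_fac hw) ⟨_, ⟨Iso.refl _⟩⟩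
  have hq' : adj.unit.app B ≫ U.map ((adj.homEquiv B Q').symm (q ≫ i.inv)) = q ≫ i.inv := by
    exact (adj.homEquiv_unit ..).symm.trans (Equiv.apply_symm_apply _ _)
  refine hcov b₀ b₁ ?_
  rw [← cancel_mono i.inv, Category.assoc, Category.assoc, ← hq', reassoc_of% hb]

end Exact

/-! ### The comparison map, element by element -/

section Pullback

variable {C : Type u} [Category.{v} C] [BarrExact C] [Goursat C]
  {X : Type u'} [Category.{v'} X] {I : C ⥤ X} {U : X ⥤ C} {adj : I ⊣ U}
  {P A D B : C} {p₁ : P ⟶ A} {p₂ : P ⟶ D} {p : A ⟶ B} {g : D ⟶ B}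

theorem unit_comp_eq {C : Type u} [Category.{v} C] {X : Type u'} [Category.{v'} X] {I : C ⥤ X}
    {U : X ⥤ C} {adj : I ⊣ U} {T : C} {P A : C} (f : P ⟶ A) {x y : T ⟶ P}
    (h : x ≫ adj.unit.app P = y ≫ adj.unit.app P) :
    x ≫ f ≫ adj.unit.app A = y ≫ f ≫ adj.unit.app A := by
  have hf : f ≫ adj.unit.app A = adj.unit.app P ≫ U.map (I.map f) := adj.unit.naturality f
  rw [hf, reassoc_of% h]

/-- The reflections of the legs of a pullback of regular epimorphisms are jointly covering. -/
theorem IsBirkhoff.exists_lift_pullback (hX : IsBirkhoff adj) (sq : IsPullback p₁ p₂ p g)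
    [IsRegularEpi p] [IsRegularEpi g] {T : C} (a : T ⟶ A) (d : T ⟶ D)
    (h : a ≫ p ≫ adj.unit.app B = d ≫ g ≫ adj.unit.app B) :
    ∃ (T' : C) (c : T' ⟶ T) (z : T' ⟶ P), IsRegularEpi c ∧
      z ≫ p₁ ≫ adj.unit.app A = c ≫ a ≫ adj.unit.app A ∧
      z ≫ p₂ ≫ adj.unit.app D = c ≫ d ≫ adj.unit.app D := by
  have hp₁ : IsRegularEpi p₁ :=
    Regular.regularEpiIsStableUnderBaseChange.of_isPullback sq.flip ‹IsRegularEpi g›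
  have hp₂ : IsRegularEpi p₂ :=
    Regular.regularEpiIsStableUnderBaseChange.of_isPullback sq ‹IsRegularEpi p›
  have hr := isRegularEpi_comp p₁ p
  obtain ⟨T₁, c₁, x, hc₁, hx⟩ := exists_lift p₁ a
  obtain ⟨T₂, c₂, y, hc₂, hy⟩ := exists_lift p₂ (c₁ ≫ d)
  obtain ⟨T₃, c₃, x', y', hc₃, hx', hy', hxy⟩ := hX.exists_lift_kernel (p₁ ≫ p)
    (c₂ ≫ c₁ ≫ a ≫ p) (c₂ ≫ c₁ ≫ d ≫ g) (by simp [h])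
  -- After permuting, `z₁` and `z₂` agree over `B`, so `z₁ ≫ p₁` and `z₂ ≫ p₂` glue to an element of
  -- `P`.
  obtain ⟨T₄, c₄, z₁, z₂, hc₄, hz₁, hz, hz₂⟩ := exists_permute (p₁ ≫ p) (adj.unit.app P)
    (x₀ := c₃ ≫ c₂ ≫ x) (x₃ := c₃ ≫ y) (by simp [hx', reassoc_of% hx]) hxy
    (by rw [Category.assoc, hy', sq.w, reassoc_of% hy])
  have := isRegularEpi_comp c₂ c₁
  have := isRegularEpi_comp c₃ (c₂ ≫ c₁)
  refine ⟨T₄, c₄ ≫ c₃ ≫ c₂ ≫ c₁, sq.lift (z₁ ≫ p₁) (z₂ ≫ p₂) (by simp [hz, ← sq.w]),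
    isRegularEpi_comp _ _, ?_, ?_⟩
  · have := unit_comp_eq (adj := adj) p₁ (x := c₄ ≫ c₃ ≫ c₂ ≫ x) (y := z₁) (by simpa using hz₁)
    simp only [Category.assoc, reassoc_of% hx] at this
    simp [this]
  · have := unit_comp_eq (adj := adj) p₂ (x := z₂) (y := c₄ ≫ c₃ ≫ y) (by simpa using hz₂)
    simp only [Category.assoc, reassoc_of% hy] at this
    simp [this]

/-- The reflections of the legs of a pullback of a split epimorphism along a regular epimorphism
are jointly monic. -/
theorem IsBirkhoff.unit_eq_of_legs_eq (hX : IsBirkhoff adj) (sq : IsPullback p₁ p₂ p g)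
    [IsRegularEpi p] [IsSplitEpi g] {T : C} (x y : T ⟶ P)
    (h₁ : x ≫ p₁ ≫ adj.unit.app A = y ≫ p₁ ≫ adj.unit.app A)
    (h₂ : x ≫ p₂ ≫ adj.unit.app D = y ≫ p₂ ≫ adj.unit.app D) :
    x ≫ adj.unit.app P = y ≫ adj.unit.app P := by
  have hp₂ : IsRegularEpi p₂ :=
    Regular.regularEpiIsStableUnderBaseChange.of_isPullback sq ‹IsRegularEpi p›
  -- The section of `g` induces a section of `p₁`.
  let e : A ⟶ P := sq.lift (𝟙 A) (p ≫ section_ g) (by simp)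
  have e₁ : e ≫ p₁ = 𝟙 A := sq.lift_fst _ _ _
  have e₂ : e ≫ p₂ = p ≫ section_ g := sq.lift_snd _ _ _
  obtain ⟨T', c, x', y', hc, hx', hy', hxy⟩ := hX.exists_lift_kernel p₂ (x ≫ p₂) (y ≫ p₂)
    (by simpa using h₂)
  -- Case of equal `p₂`-components: shift from the images under `p₁ ≫ e`, as `p₁` and `p₂` are
  -- jointly monic.
  have key : ∀ ⦃W : C⦄ (a b : W ⟶ P), a ≫ p₂ = b ≫ p₂ →
      a ≫ p₁ ≫ adj.unit.app A = b ≫ p₁ ≫ adj.unit.app A →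
      a ≫ adj.unit.app P = b ≫ adj.unit.app P := by
    intro W a b hab hab'
    refine shifting p₁ p₂ (adj.unit.app P)
      (fun V s t hs ht => by rw [sq.hom_ext hs ht])
      (u := a ≫ p₁ ≫ e) (v := b ≫ p₁ ≫ e) (by simp [e₁]) (by simp [e₁]) hab
      (by simp [e₂, reassoc_of% sq.w, reassoc_of% hab]) ?_
    simpa using unit_comp_eq (adj := adj) e (x := a ≫ p₁) (y := b ≫ p₁) (by simpa using hab')
  rw [← cancel_epi c, ← Category.assoc, ← Category.assoc]
  -- General case: shift from `x'`, `y'`, which have the same `p₂`-components as `x`, `y`; `key`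
  -- replaces joint monicity.
  refine shifting p₂ (p₁ ≫ adj.unit.app A) (adj.unit.app P) key (u := x') (v := y')
    (by simpa using hx'.symm) (by simpa using hy'.symm) (by simp [h₁]) ?_ hxy
  exact unit_comp_eq p₁ hxy

end Pullback

end GoursatReflection

theorem corollary2p2 {C : Type u} [Category.{v} C]
    [GoursatReflection.BarrExact C] [GoursatReflection.Goursat C]
    {X : Type u'} [Category.{v'} X] {I : C ⥤ X} {U : X ⥤ C} (adj : I ⊣ U)
    (hX : GoursatReflection.IsBirkhoff adj)
    {P A D B : C} {p₁ : P ⟶ A} {p₂ : P ⟶ D} {p : A ⟶ B} {g : D ⟶ B}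
    (hp : IsRegularEpi p) (hg : IsSplitEpi g) (sq : IsPullback p₁ p₂ p g) :
    IsPullback (I.map p₁) (I.map p₂) (I.map p) (I.map g) := by
  have := hX.full
  have := hX.faithful
  have hA := hX.isRegularEpi_unit A
  have hD := hX.isRegularEpi_unit D
  have hP := hX.isRegularEpi_unit P
  have nat {Y Z : C} (f : Y ⟶ Z) :
      adj.unit.app Y ≫ U.map (I.map f) = f ≫ adj.unit.app Z := (adj.unit.naturality f).symm
  have w : U.map (I.map p₁) ≫ U.map (I.map p) = U.map (I.map p₂) ≫ U.map (I.map g) := by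
    simp only [← Functor.map_comp, sq.w]
  let φ : U.obj (I.obj P) ⟶ pullback (U.map (I.map p)) (U.map (I.map g)) := pullback.lift _ _ w
  have φ₁ : φ ≫ pullback.fst _ _ = U.map (I.map p₁) := pullback.lift_fst _ _ _
  have φ₂ : φ ≫ pullback.snd _ _ = U.map (I.map p₂) := pullback.lift_snd _ _ _
  have epi : IsRegularEpi φ := by
    obtain ⟨T₁, c₁, a, hc₁, ha⟩ := GoursatReflection.exists_lift (adj.unit.app A)
      (pullback.fst (U.map (I.map p)) (U.map (I.map g)))
    obtain ⟨T₂, c₂, d, hc₂, hd⟩ := GoursatReflection.exists_lift (adj.unit.app D)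
      (c₁ ≫ pullback.snd (U.map (I.map p)) (U.map (I.map g)))
    obtain ⟨T₃, c₃, z, hc₃, hz₁, hz₂⟩ := hX.exists_lift_pullback sq (c₂ ≫ a) d (by
      rw [← nat, ← nat, Category.assoc, reassoc_of% ha, reassoc_of% hd, pullback.condition])
    have := GoursatReflection.isRegularEpi_comp c₂ c₁
    have := GoursatReflection.isRegularEpi_comp c₃ (c₂ ≫ c₁)
    -- A cover of the pullback factors through `φ`.
    refine GoursatReflection.isRegularEpi_of_fac (f := z ≫ adj.unit.app P)
      (h := c₃ ≫ c₂ ≫ c₁) ?_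
    ext
    · simp [φ₁, nat, hz₁, ha]
    · simp [φ₂, nat, hz₂, hd]
  have mono : Mono φ := by
    refine ⟨fun {T} m₀ m₁ hm => ?_⟩
    obtain ⟨T₁, c₁, x, hc₁, hx⟩ := GoursatReflection.exists_lift (adj.unit.app P) m₀
    obtain ⟨T₂, c₂, y, hc₂, hy⟩ := GoursatReflection.exists_lift (adj.unit.app P) (c₁ ≫ m₁)
    rw [← cancel_epi c₁, ← cancel_epi c₂, ← hy, ← hx, ← Category.assoc]
    apply hX.unit_eq_of_legs_eq sq
    · rw [← nat, Category.assoc, reassoc_of% hx, reassoc_of% hy, ← φ₁, reassoc_of% hm]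
    · rw [← nat, Category.assoc, reassoc_of% hx, reassoc_of% hy, ← φ₂, reassoc_of% hm]
  have iso : IsIso φ := isIso_of_mono_of_strongEpi φ
  refine IsPullback.of_map U (by simp only [← Functor.map_comp, sq.w]) ?_
  exact IsPullback.of_iso_pullback ⟨w⟩ (asIso φ) φ₁ φ₂
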